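/- Let $G$ be a locally compact (Hausdorff) abelian group with Haar measure $\mu$ and dual group $\Gamma$ (the continuous characters $\chi : G \to \mathbb{T}$, with the compact-open topology). For $a \in L^1(G)$ and $\chi\in\Gamma$ put $\widehat a(\chi) = \int_G a(s)\chi(s)\,d\mu(s)$. For $\Lambda \subset \Gamma$ let $J_\Lambda$ be the set of all $a \in L^1(G)$ such that $\widehat a$ vanishes in a neighbourhood of each $\chi\in\Lambda$, and let $K_\Lambda = \{a \in L^1(G) : \widehat a(\chi) = 0 \text{ for all } \chi\in\Lambda\}$. Let $T$ be a representation of $G$ by unitary operators on a complex Hilbert space $X$, that is, a strongly continuous homomorphism from $G$ into the group of unitary operators on $X$. For $a \in L^1(G)$ let $\widehat a(T)$ be the bounded operator on $X$ given by $\widehat a(T)x = \int_G a(s)T(s)x\,d\mu(s)$ for $x\in X$. Let $$\mathrm{Sp}(T) = \bigcap\Big\{\Lambda\subset\Gamma : \Lambda \text{ is closed and } \bigcap_{b\in J_\Lambda}\ker \widehat b(T) = X\Big\}$$ be the (Arveson) spectrum of $T$. Then, for every $a\in L^1(G)$, $$\|\widehat a(T)\| = \sup\{|\widehat a(\chi)|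 : \chi\in \mathrm{Sp}(T)\},$$ where the set on the right is bounded and the supremum of the empty set is $0$ (this only matters if $X=\{0\}$). Moreover, $\widehat a(T) = 0$ if and only if $a\in K_{\mathrm{Sp}(T)}$, that is, if and only if $\widehat a(\chi) = 0$ for all $\chi\in\mathrm{Sp}(T)$. -/

import Mathlib

open MeasureTheory Topology Filter

noncomputable section

/-- A representation of a topological group `G` (written multiplicatively) on a complex normed
space `X`: a strongly continuous homomorphism into the bounded operators on `X`, mapping the
identity element to the identity operator. -/
structure StrongRep (G X : Type*) [Group G] [TopologicalSpace G]
    [NormedAddCommGroup X] [NormedSpace ℂ X] where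
  /-- the underlying homomorphism -/
  toHom : G →* (X →L[ℂ] X)
  /-- strong continuity -/
  continuous_apply : ∀ x : X, Continuous fun s : G => toHom s x

namespace StrongRep

/-- The representation is bounded: `sup_s ‖T(s)‖ < ∞`. -/
def IsBounded {G X : Type*} [Group G] [TopologicalSpace G]
    [NormedAddCommGroup X] [NormedSpace ℂ X] (T : StrongRep G X) : Prop :=
  ∃ M : ℝ, ∀ s : G, ‖T.toHom s‖ ≤ M

/-- The representation is by unitary operators on a Hilbert space. -/
def IsUnitary {G X : Type*} [Group G] [TopologicalSpace G]
    [NormedAddCommGroup X] [InnerProductSpace ℂ X] [CompleteSpace X]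
    (T : StrongRep G X) : Prop :=
  ∀ s : G, T.toHom s ∈ unitary (X →L[ℂ] X)

/-- Unitary representations are bounded. -/
theorem IsUnitary.isBounded {G X : Type*} [Group G] [TopologicalSpace G]
    [NormedAddCommGroup X] [InnerProductSpace ℂ X] [CompleteSpace X]
    {T : StrongRep G X} (hT : T.IsUnitary) : T.IsBounded := by
  refine ⟨1, fun s => ContinuousLinearMap.opNorm_le_bound _ zero_le_one fun x => ?_⟩
  rw [one_mul]
  exact (ContinuousLinearMap.norm_map_of_mem_unitary (hT s) x).le

end StrongRep

/-- A continuous function is strongly measurable on every set of finite measure, for a regular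
measure (no second countability is needed). -/
theorem aestronglyMeasurable_restrict_of_continuous {G X : Type*} [TopologicalSpace G]
    [R1Space G] [MeasurableSpace G] [BorelSpace G] [NormedAddCommGroup X]
    (μ : Measure G) [μ.Regular] {f : G → X} (hf : Continuous f)
    {s : Set G} (hs : MeasurableSet s) (hμs : μ s ≠ ⊤) :
    AEStronglyMeasurable f (μ.restrict s) := by
  choose K hKs hKco hKcl hKlt using fun n : ℕ =>
    hs.exists_isCompact_isClosed_sdiff_lt hμs (ε := ((n : ENNReal) + 1)⁻¹) (by simp)
  have hlim : Tendsto (fun n : ℕ => ((n : ENNReal) + 1)⁻¹) atTop (𝓝 0) := by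
    have := (tendsto_add_atTop_iff_nat 1).2 ENNReal.tendsto_inv_nat_nhds_zero
    simpa using this
  have hnull : μ (s \ ⋃ n, K n) = 0 := by
    refine le_antisymm (ge_of_tendsto' hlim fun n => ?_) zero_le
    exact (measure_mono (Set.sdiff_subset_sdiff_right (Set.subset_iUnion K n))).trans (hKlt n).le
  have heq : s =ᵐ[μ] ⋃ n, K n :=
    (ae_le_set.2 hnull).antisymm (Set.iUnion_subset hKs).eventuallyLE
  rw [Measure.restrict_congr_set heq, aestronglyMeasurable_iUnion_iff]
  exact fun n => hf.continuousOn.aestronglyMeasurable_of_isCompact (hKco n) (hKcl n).measurableSet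

/-- If `a ∈ L¹(G)` and `f` is continuous and bounded, then `a • f` is Bochner integrable. -/
theorem integrable_smul_of_continuous_bounded {G X : Type*} [TopologicalSpace G] [R1Space G]
    [MeasurableSpace G] [BorelSpace G]
    [NormedAddCommGroup X] [NormedSpace ℂ X] (μ : Measure G) [μ.Regular]
    {a : G → ℂ} (ha : Integrable a μ) (ham : StronglyMeasurable a)
    {f : G → X} (hf : Continuous f) {M : ℝ}
    (hM : ∀ s, ‖f s‖ ≤ M) : Integrable (fun s => a s • f s) μ := by
  have hmeas : AEStronglyMeasurable (fun s => a s • f s) μ := by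
    have hS : ∀ n : ℕ, MeasurableSet {s | ((n : ℝ) + 1)⁻¹ ≤ ‖a s‖} := fun n =>
      measurableSet_le measurable_const ham.norm.measurable
    have hU : AEStronglyMeasurable f
        (μ.restrict (⋃ n : ℕ, {s | ((n : ℝ) + 1)⁻¹ ≤ ‖a s‖})) := by
      rw [aestronglyMeasurable_iUnion_iff]
      exact fun n => aestronglyMeasurable_restrict_of_continuous μ hf (hS n)
        (ha.measure_norm_ge_lt_top (by positivity)).ne
    have hind := (aestronglyMeasurable_indicator_iff (MeasurableSet.iUnion hS)).2
      (ham.aestronglyMeasurable.smul hU)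
    refine hind.congr (Eventually.of_forall fun s => ?_)
    refine congrFun (Set.indicator_eq_self.2 fun t ht => ?_) s
    have hat : a t ≠ 0 := fun h => ht (by simp [h])
    obtain ⟨n, hn⟩ := exists_nat_one_div_lt (norm_pos_iff.2 hat)
    exact Set.mem_iUnion.2 ⟨n, by simpa using hn.le⟩
  refine (ha.norm.mul_const M).mono' hmeas (Eventually.of_forall fun s => ?_)
  rw [norm_smul]
  exact mul_le_mul_of_nonneg_left (hM s) (norm_nonneg _)

section L1

variable {G : Type*} [CommGroup G] [TopologicalSpace G] [MeasurableSpace G]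

/-- The Fourier transform `â(χ) = ∫ a(s) χ(s) dμ(s)` of `a ∈ L¹(G)` at a character `χ`. -/
def fourierL1 (μ : Measure G) (a : Lp ℂ 1 μ) (χ : PontryaginDual G) : ℂ :=
  ∫ s, a s * (χ s : ℂ) ∂μ

/-- `J_Λ`: those `a ∈ L¹(G)` whose Fourier transform vanishes in a neighbourhood of
each point of `Λ`. -/
def idealJ (μ : Measure G) (Λ : Set (PontryaginDual G)) : Set (Lp ℂ 1 μ) :=
  {a | ∀ χ ∈ Λ, ∀ᶠ ψ in 𝓝 χ, fourierL1 μ a ψ = 0}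

/-- `K_Λ`: those `a ∈ L¹(G)` whose Fourier transform vanishes on `Λ`. -/
def idealK (μ : Measure G) (Λ : Set (PontryaginDual G)) : Set (Lp ℂ 1 μ) :=
  {a | ∀ χ ∈ Λ, fourierL1 μ a χ = 0}

end L1

namespace StrongRep

variable {G : Type*} [CommGroup G] [TopologicalSpace G] [IsTopologicalGroup G]
  [MeasurableSpace G] [BorelSpace G]
  {X : Type*} [NormedAddCommGroup X] [NormedSpace ℂ X]

/-- The integrand `a(s) T(s) x` defining `â(T) x` is Bochner integrable. -/
theorem integrable_smul_apply (μ : Measure G) [μ.Regular] (T : StrongRep G X)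
    (hT : T.IsBounded) (a : Lp ℂ 1 μ) (x : X) :
    Integrable (fun s => a s • T.toHom s x) μ := by
  obtain ⟨M, hM⟩ := hT
  exact integrable_smul_of_continuous_bounded μ (L1.integrable_coeFn a)
    (Lp.stronglyMeasurable a) (T.continuous_apply x)
    fun s => (T.toHom s).le_of_opNorm_le (hM s) x

/-- The bounded operator `â(T)` given by `â(T) x = ∫ a(s) T(s) x dμ(s)`. -/
def hatOp (μ : Measure G) [μ.Regular] (T : StrongRep G X)
    (hT : T.IsBounded) (a : Lp ℂ 1 μ) : X →L[ℂ] X :=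
  LinearMap.mkContinuousOfExistsBound
    { toFun := fun x => ∫ s, a s • T.toHom s x ∂μ
      map_add' := fun x y => by
        simp only [map_add, smul_add]
        exact integral_add (T.integrable_smul_apply μ hT a x) (T.integrable_smul_apply μ hT a y)
      map_smul' := fun c x => by
        simp only [map_smul, RingHom.id_apply]
        rw [← integral_smul]
        exact integral_congr_ae (Eventually.of_forall fun s => smul_comm _ _ _) }
    (by
      obtain ⟨M, hM⟩ := hT
      refine ⟨∫ s, ‖a s‖ * M ∂μ, fun x => ?_⟩
      rw [← integral_mul_const]
      refine norm_integral_le_of_norm_le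
        (((L1.integrable_coeFn a).norm.mul_const M).mul_const _)
        (Eventually.of_forall fun s => ?_)
      rw [norm_smul, mul_assoc]
      exact mul_le_mul_of_nonneg_left ((T.toHom s).le_of_opNorm_le (hM s) x) (norm_nonneg _))

theorem hatOp_apply (μ : Measure G) [μ.Regular] (T : StrongRep G X)
    (hT : T.IsBounded) (a : Lp ℂ 1 μ) (x : X) :
    T.hatOp μ hT a x = ∫ s, a s • T.toHom s x ∂μ := rfl

/-- The spectral subspace `M_T(Λ) = ⋂_{a ∈ J_Λ} ker â(T)`. -/
def spectralSubspace (μ : Measure G) [μ.Regular] (T : StrongRep G X)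
    (hT : T.IsBounded) (Λ : Set (PontryaginDual G)) : Submodule ℂ X :=
  ⨅ a ∈ idealJ μ Λ, LinearMap.ker (T.hatOp μ hT a : X →ₗ[ℂ] X)

/-- The (Arveson) spectrum `Sp(T)`: the intersection of all closed `Λ` with `M_T(Λ) = X`. -/
def arvesonSpectrum (μ : Measure G) [μ.Regular] (T : StrongRep G X)
    (hT : T.IsBounded) : Set (PontryaginDual G) :=
  ⋂₀ {Λ | IsClosed Λ ∧ T.spectralSubspace μ hT Λ = ⊤}

end StrongRep

end

/-! The bicommutant of `T(G)` is a commutative unital C⋆-algebra containing every `â(T)`, so the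
Gelfand transform gives `‖â(T)‖ = max |φ(â(T))|` over its characters `φ`. If `φ` does not kill all
the `â(T)`, then `s ↦ φ(T(s))` is a continuous character `χ` of `G`, and `φ(b̂(T)) = b̂(χ)` for all
`b`. These `χ` form the Gelfand spectrum `S`, on which `|â|` attains `‖â(T)‖` whenever `â(T) ≠ 0`.

It remains to show `S ⊆ Sp(T) ⊆ closure S`; continuity of `â` then gives the theorem. If `b ∈ J` of
`closure S`, then `b̂ = 0` on `S`, so `b̂(T) = 0`; this is the second inclusion. The first needs
regularity of `L¹(G)`: some `b ∈ J_Λ` has `b̂(χ₀) ≠ 0` when `χ₀` lies off the closed set `Λ`.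

Regularity comes from the same Gelfand theory applied to `L²(G)`, with no appeal to Plancherel or
Bochner. A nonzero `u ∈ L²(G)` with spectrum in a small open `V` is orthogonal to `χu` unless `χV`
meets `V`. Since `⟨u, χu⟩` is the Fourier transform of `|u|²` at `χ`, a modulation of `|u|²` serves
as `b`. -/

noncomputable section

namespace StrongRep

/-! ### The bicommutant as a commutative C⋆-algebra -/

section Bicommutant

variable {G X : Type*} [CommGroup G] [TopologicalSpace G]
  [NormedAddCommGroup X] [InnerProductSpace ℂ X] [CompleteSpace X]

/-- The bicommutant of the operators `T(s)`. -/
def bicommutant (T : StrongRep G X) : StarSubalgebra ℂ (X →L[ℂ] X) :=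
  StarSubalgebra.centralizer ℂ (StarSubalgebra.centralizer ℂ (Set.range T.toHom))

theorem mem_bicommutant_of_forall {T : StrongRep G X} {z : X →L[ℂ] X}
    (h : ∀ y : X →L[ℂ] X, (∀ s, T.toHom s * y = y * T.toHom s) → y * z = z * y) :
    z ∈ T.bicommutant := by
  have key : ∀ y ∈ StarSubalgebra.centralizer ℂ (Set.range T.toHom), y * z = z * y :=
    fun y hy => h y fun s =>
      ((StarSubalgebra.mem_centralizer_iff ℂ).1 hy _ (Set.mem_range_self s)).1
  exact (StarSubalgebra.mem_centralizer_iff ℂ).2 fun y hy => ⟨key y hy, key _ (star_mem hy)⟩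

theorem toHom_mem_bicommutant (T : StrongRep G X) (s : G) : T.toHom s ∈ T.bicommutant :=
  mem_bicommutant_of_forall fun _ hy => (hy s).symm

theorem IsUnitary.star_toHom {T : StrongRep G X} (hT : T.IsUnitary) (s : G) :
    star (T.toHom s) = T.toHom s⁻¹ := by
  have h : T.toHom s * T.toHom s⁻¹ = 1 := by rw [← map_mul, mul_inv_cancel, map_one]
  calc star (T.toHom s) = star (T.toHom s) * (T.toHom s * T.toHom s⁻¹) := by rw [h, mul_one]
    _ = T.toHom s⁻¹ := by rw [← mul_assoc, (Unitary.mem_iff.1 (hT s)).1, one_mul]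

/-- Since `T(s)* = T(s⁻¹)`, the set `T(G)` is self-adjoint and the adjoint half of the commutation
condition is automatic. -/
theorem IsUnitary.mem_centralizer_iff {T : StrongRep G X} (hT : T.IsUnitary) {y : X →L[ℂ] X} :
    y ∈ StarSubalgebra.centralizer ℂ (Set.range T.toHom) ↔
      ∀ s, T.toHom s * y = y * T.toHom s := by
  rw [StarSubalgebra.mem_centralizer_iff, Set.forall_mem_range]
  exact ⟨fun h s => (h s).1, fun h s => ⟨h s, by rw [hT.star_toHom]; exact h _⟩⟩

theorem IsUnitary.mem_bicommutant_iff {T : StrongRep G X} (hT : T.IsUnitary) {z : X →L[ℂ] X} :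
    z ∈ T.bicommutant ↔
      ∀ y : X →L[ℂ] X, (∀ s, T.toHom s * y = y * T.toHom s) → y * z = z * y :=
  ⟨fun hz _ hy => ((StarSubalgebra.mem_centralizer_iff ℂ).1 hz _
    (hT.mem_centralizer_iff.2 hy)).1, mem_bicommutant_of_forall⟩

theorem isClosed_bicommutant (T : StrongRep G X) :
    IsClosed (T.bicommutant : Set (X →L[ℂ] X)) := by
  rw [bicommutant, StarSubalgebra.coe_centralizer]
  exact Set.isClosed_centralizer _

/-- As `G` is abelian, each `T(s)` lies in the commutant; hence the bicommutant lies in the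
commutant, and so commutes with itself. -/
theorem IsUnitary.mul_comm_of_mem_bicommutant {T : StrongRep G X} (hT : T.IsUnitary)
    {y z : X →L[ℂ] X} (hy : y ∈ T.bicommutant) (hz : z ∈ T.bicommutant) : y * z = z * y := by
  refine hT.mem_bicommutant_iff.1 hz y fun s => hT.mem_bicommutant_iff.1 hy _ fun t => ?_
  rw [← map_mul, ← map_mul, mul_comm]

/-- The bicommutant of a unitary representation of an abelian group is a commutative
C⋆-algebra. -/
def IsUnitary.commCStarAlgebra {T : StrongRep G X} (hT : T.IsUnitary) :
    CommCStarAlgebra T.bicommutant :=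
  { StarSubalgebra.cstarAlgebra T.bicommutant (h_closed := T.isClosed_bicommutant) with
    mul_comm := fun y z => Subtype.ext (hT.mul_comm_of_mem_bicommutant y.2 z.2) }

end Bicommutant

/-! ### The operators `â(T)` in the bicommutant -/

section Hat

variable {G : Type*} [CommGroup G] [TopologicalSpace G] [IsTopologicalGroup G]
  [MeasurableSpace G] [BorelSpace G]
  {X : Type*} [NormedAddCommGroup X] [InnerProductSpace ℂ X] [CompleteSpace X]
  (μ : Measure G) [μ.Regular] {T : StrongRep G X}

theorem hatOp_comm_of_forall (hT : T.IsBounded) (a : Lp ℂ 1 μ) {y : X →L[ℂ] X}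
    (hy : ∀ s, T.toHom s * y = y * T.toHom s) : y * T.hatOp μ hT a = T.hatOp μ hT a * y := by
  ext x
  simp only [mul_apply_eq_comp, hatOp_apply]
  rw [← ContinuousLinearMap.integral_comp_comm _ (T.integrable_smul_apply μ hT a x)]
  refine integral_congr_ae (Eventually.of_forall fun s => ?_)
  have := DFunLike.congr_fun (hy s) x
  simp only [mul_apply_eq_comp] at this
  simp [this]

theorem hatOp_mem_bicommutant (hT : T.IsBounded) (a : Lp ℂ 1 μ) :
    T.hatOp μ hT a ∈ T.bicommutant :=
  mem_bicommutant_of_forall fun _ hy => hatOp_comm_of_forall μ hT a hy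

omit [CompleteSpace X] in
theorem hatOp_sub (hT : T.IsBounded) (a b : Lp ℂ 1 μ) :
    T.hatOp μ hT (a - b) = T.hatOp μ hT a - T.hatOp μ hT b := by
  ext x
  rw [sub_apply, hatOp_apply, hatOp_apply, hatOp_apply,
    ← integral_sub (T.integrable_smul_apply μ hT a x) (T.integrable_smul_apply μ hT b x)]
  refine integral_congr_ae ((Lp.coeFn_sub a b).mono fun s hs => ?_)
  simp only [hs, Pi.sub_apply, sub_smul]

theorem IsUnitary.norm_hatOp_le (hT : T.IsUnitary) (a : Lp ℂ 1 μ) :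
    ‖T.hatOp μ hT.isBounded a‖ ≤ ‖a‖ := by
  refine ContinuousLinearMap.opNorm_le_bound _ (norm_nonneg _) fun x => ?_
  rw [hatOp_apply, L1.norm_eq_integral_norm, ← integral_mul_const]
  refine norm_integral_le_of_norm_le ((L1.integrable_coeFn a).norm.mul_const _)
    (Eventually.of_forall fun s => ?_)
  rw [norm_smul, ContinuousLinearMap.norm_map_of_mem_unitary (hT s) x]

theorem IsUnitary.continuous_hatOp (hT : T.IsUnitary) :
    Continuous fun a : Lp ℂ 1 μ => T.hatOp μ hT.isBounded a := by
  refine (LipschitzWith.of_dist_le_mul (K := 1) fun a b => ?_).continuous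
  rw [dist_eq_norm, dist_eq_norm, ← hatOp_sub, NNReal.coe_one, one_mul]
  exact hT.norm_hatOp_le μ _

open DomMulAct in
theorem toHom_mul_hatOp [μ.IsMulLeftInvariant] (hT : T.IsBounded) (a : Lp ℂ 1 μ) (s : G) :
    T.toHom s * T.hatOp μ hT a = T.hatOp μ hT (DomMulAct.mk s⁻¹ • a) := by
  ext x
  rw [mul_apply_eq_comp, hatOp_apply, hatOp_apply,
    ← ContinuousLinearMap.integral_comp_comm _ (T.integrable_smul_apply μ hT a x),
    ← integral_mul_left_eq_self _ s⁻¹]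
  refine integral_congr_ae ((smul_Lp_ae_eq (DomMulAct.mk s⁻¹) a).mono fun t ht => ?_)
  simp only [ht, Equiv.symm_apply_apply, smul_eq_mul, map_smul]
  rw [← mul_apply_eq_comp, ← map_mul, mul_inv_cancel_left]

/-- `T` is only strongly continuous, but multiplying by `â(T)` turns `T(s)` into the operator of a
translate of `a`, and translation is norm continuous in `L¹`. -/
theorem IsUnitary.continuous_toHom_mul_hatOp [LocallyCompactSpace G] [μ.IsMulLeftInvariant] (hT : T.IsUnitary)
    (a : Lp ℂ 1 μ) : Continuous fun s => T.toHom s * T.hatOp μ hT.isBounded a := by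
  simp_rw [toHom_mul_hatOp]
  have : Fact ((1 : ENNReal) ≠ ⊤) := ⟨ENNReal.one_ne_top⟩
  refine (hT.continuous_hatOp μ).comp ?_
  have : Continuous fun s : G => DomMulAct.mk s⁻¹ :=
    DomMulAct.continuous_mk.comp continuous_inv
  exact this.smul continuous_const

end Hat

end StrongRep

/-! ### Gelfand characters and the characters of `G` they induce -/

namespace StrongRep

namespace IsUnitary

open WeakDual

section Alg

variable {G X : Type*} [CommGroup G] [TopologicalSpace G]
  [NormedAddCommGroup X] [InnerProductSpace ℂ X] [CompleteSpace X]
  {T : StrongRep G X}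

/-- The bicommutant of a unitary representation as a commutative C⋆-algebra. -/
def Alg (_hT : T.IsUnitary) : Type _ := T.bicommutant

instance (hT : T.IsUnitary) : CommCStarAlgebra hT.Alg := hT.commCStarAlgebra

/-- The inclusion of the bicommutant into the bounded operators. -/
def val (hT : T.IsUnitary) : hT.Alg →⋆ₐ[ℂ] (X →L[ℂ] X) where
  toFun := Subtype.val
  map_one' := rfl
  map_mul' _ _ := rfl
  map_zero' := rfl
  map_add' _ _ := rfl
  commutes' _ := rfl
  map_star' _ := rfl

theorem norm_val (hT : T.IsUnitary) (z : hT.Alg) : ‖hT.val z‖ = ‖z‖ := rfl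

theorem val_injective (hT : T.IsUnitary) : Function.Injective hT.val := Subtype.val_injective

/-- The operator `T(s)` as an element of the bicommutant. -/
def op (hT : T.IsUnitary) : G →* hT.Alg where
  toFun s := ⟨T.toHom s, T.toHom_mem_bicommutant s⟩
  map_one' := Subtype.ext (map_one T.toHom)
  map_mul' s t := Subtype.ext (map_mul T.toHom s t)

theorem val_op (hT : T.IsUnitary) (s : G) : hT.val (hT.op s) = T.toHom s := rfl

theorem norm_character_op (hT : T.IsUnitary) (φ : characterSpace ℂ hT.Alg) (s : G) :
    ‖φ (hT.op s)‖ = 1 := by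
  have h : star (hT.op s) * hT.op s = 1 := hT.val_injective (Unitary.mem_iff.1 (hT s)).1
  have h2 : ‖φ (hT.op s)‖ ^ 2 = 1 := by
    have := congrArg φ h
    rw [map_mul, map_star, map_one] at this
    have := congrArg norm this
    rwa [norm_mul, norm_star, ← sq, norm_one] at this
  exact (pow_eq_one_iff_of_nonneg (norm_nonneg _) two_ne_zero).1 h2

end Alg

section Hat

variable {G : Type*} [CommGroup G] [TopologicalSpace G] [IsTopologicalGroup G]
  [MeasurableSpace G] [BorelSpace G]
  {X : Type*} [NormedAddCommGroup X] [InnerProductSpace ℂ X] [CompleteSpace X]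
  (μ : Measure G) [μ.Regular] {T : StrongRep G X}

/-- The operator `â(T)` as an element of the bicommutant. -/
def hat (hT : T.IsUnitary) (a : Lp ℂ 1 μ) : hT.Alg :=
  ⟨T.hatOp μ hT.isBounded a, hatOp_mem_bicommutant μ hT.isBounded a⟩

theorem val_hat (hT : T.IsUnitary) (a : Lp ℂ 1 μ) :
    hT.val (hT.hat μ a) = T.hatOp μ hT.isBounded a := rfl

theorem norm_op_mul_hat_le (hT : T.IsUnitary) (a : Lp ℂ 1 μ) (s : G) :
    ‖hT.op s * hT.hat μ a‖ ≤ ‖hT.hat μ a‖ := by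
  refine ContinuousLinearMap.opNorm_le_bound (hT.val (hT.op s * hT.hat μ a))
    (norm_nonneg _) fun x => ?_
  rw [map_mul, mul_apply_eq_comp, val_op, ContinuousLinearMap.norm_map_of_mem_unitary (hT s)]
  exact (hT.val (hT.hat μ a)).le_opNorm x

variable [LocallyCompactSpace G] [μ.IsMulLeftInvariant]

theorem continuous_op_mul_hat (hT : T.IsUnitary) (a : Lp ℂ 1 μ) :
    Continuous fun s => hT.op s * hT.hat μ a :=
  Continuous.subtype_mk (hT.continuous_toHom_mul_hatOp μ a) _

/-- The factor `â(T)` upgrades the strong integral defining `b̂(T)` to a norm-convergent one,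
through which a Gelfand character can pass. -/
theorem hat_mul_hat (hT : T.IsUnitary) (a b : Lp ℂ 1 μ) :
    hT.hat μ b * hT.hat μ a = ∫ s, b s • (hT.op s * hT.hat μ a) ∂μ := by
  have hint : Integrable (fun s => b s • (hT.op s * hT.hat μ a)) μ :=
    integrable_smul_of_continuous_bounded μ (L1.integrable_coeFn b)
      (Lp.stronglyMeasurable b) (hT.continuous_op_mul_hat μ a) (hT.norm_op_mul_hat_le μ a)
  apply hT.val_injective
  ext x
  let L : hT.Alg →L[ℂ] X :=
    (ContinuousLinearMap.apply ℂ X x).comp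
      (⟨hT.val.toAlgHom.toLinearMap, continuous_subtype_val⟩ : hT.Alg →L[ℂ] (X →L[ℂ] X))
  exact ContinuousLinearMap.integral_comp_comm L hint

theorem exists_pontryaginDual_of_character (hT : T.IsUnitary) (φ : characterSpace ℂ hT.Alg)
    {a : Lp ℂ 1 μ} (ha : φ (hT.hat μ a) ≠ 0) :
    ∃ χ : PontryaginDual G, ∀ s, (χ s : ℂ) = φ (hT.op s) := by
  have hc : Continuous fun s => φ (hT.op s) := by
    -- Dividing by `φ(â(T)) ≠ 0` recovers `φ(T(s))` from a norm continuous function of `s`.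
    have h1 : Continuous fun s => φ (hT.op s * hT.hat μ a) / φ (hT.hat μ a) :=
      ((map_continuous φ).comp (hT.continuous_op_mul_hat μ a)).div_const _
    refine h1.congr fun s => ?_
    rw [map_mul, mul_div_cancel_right₀ _ ha]
  let f : G →ₜ* Circle :=
    { toFun := fun s => ⟨φ (hT.op s), by
        exact mem_sphere_zero_iff_norm.2 (hT.norm_character_op φ s)⟩
      map_one' := Circle.ext (by change φ (hT.op 1) = 1; rw [map_one, map_one])
      map_mul' := fun s t => Circle.ext (by
        change φ (hT.op (s * t)) = φ (hT.op s) * φ (hT.op t); rw [map_mul, map_mul])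
      continuous_toFun := hc.subtype_mk fun s =>
        mem_sphere_zero_iff_norm.2 (hT.norm_character_op φ s) }
  exact ⟨f, fun s => rfl⟩

theorem character_hat (hT : T.IsUnitary) (φ : characterSpace ℂ hT.Alg)
    {a : Lp ℂ 1 μ} (ha : φ (hT.hat μ a) ≠ 0) {χ : PontryaginDual G}
    (hχ : ∀ s, (χ s : ℂ) = φ (hT.op s)) (b : Lp ℂ 1 μ) :
    φ (hT.hat μ b) = fourierL1 μ b χ := by
  have hint : Integrable (fun s => b s • (hT.op s * hT.hat μ a)) μ :=
    integrable_smul_of_continuous_bounded μ (L1.integrable_coeFn b)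
      (Lp.stronglyMeasurable b) (hT.continuous_op_mul_hat μ a) (hT.norm_op_mul_hat_le μ a)
  have h := congrArg (CharacterSpace.toCLM φ) (hT.hat_mul_hat μ a b)
  rw [← ContinuousLinearMap.integral_comp_comm _ hint] at h
  simp only [CharacterSpace.coe_toCLM, map_mul, map_smul, smul_eq_mul, ← mul_assoc] at h
  rw [integral_mul_const] at h
  rw [mul_right_cancel₀ ha h, fourierL1]
  simp_rw [hχ]

/-- The characters of `G` induced by the Gelfand characters of the bicommutant which do not
annihilate all the operators `â(T)`. -/
def gelfandSpectrum (hT : T.IsUnitary) : Set (PontryaginDual G) :=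
  {χ | ∃ φ : characterSpace ℂ hT.Alg, (∃ a, φ (hT.hat μ a) ≠ 0) ∧ ∀ s, (χ s : ℂ) = φ (hT.op s)}

theorem norm_fourierL1_le (hT : T.IsUnitary) (a : Lp ℂ 1 μ) {χ : PontryaginDual G}
    (hχ : χ ∈ hT.gelfandSpectrum μ) :
    ‖fourierL1 μ a χ‖ ≤ ‖T.hatOp μ hT.isBounded a‖ := by
  obtain ⟨φ, ⟨b, hb⟩, hφ⟩ := hχ
  rw [← hT.character_hat μ φ hb hφ a, ← hT.val_hat μ, hT.norm_val,
    ← (gelfandTransform_isometry hT.Alg).norm_map_of_map_zero (map_zero _) (hT.hat μ a)]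
  exact ContinuousMap.norm_coe_le_norm (gelfandTransform ℂ hT.Alg (hT.hat μ a)) φ

theorem exists_norm_fourierL1_eq (hT : T.IsUnitary) {a : Lp ℂ 1 μ}
    (ha : T.hatOp μ hT.isBounded a ≠ 0) :
    ∃ χ ∈ hT.gelfandSpectrum μ, ‖fourierL1 μ a χ‖ = ‖T.hatOp μ hT.isBounded a‖ := by
  -- Nontriviality makes the compact character space nonempty, so the maximum exists.
  have hn : Nontrivial hT.Alg := ⟨hT.hat μ a, 0, fun h => ha (by rw [← val_hat, h, map_zero])⟩
  let F := gelfandTransform ℂ hT.Alg (hT.hat μ a)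
  obtain ⟨φ, -, hmax⟩ := isCompact_univ.exists_isMaxOn Set.univ_nonempty
    (map_continuous F).norm.continuousOn
  have hφ : ‖F‖ = ‖F φ‖ := le_antisymm
    ((ContinuousMap.norm_le _ (norm_nonneg _)).2 fun ψ => hmax (Set.mem_univ ψ))
    (F.norm_coe_le_norm φ)
  rw [(gelfandTransform_isometry hT.Alg).norm_map_of_map_zero (map_zero _), ← norm_val,
    val_hat] at hφ
  have hφ' : ‖T.hatOp μ hT.isBounded a‖ = ‖φ (hT.hat μ a)‖ := hφ
  have h0 : φ (hT.hat μ a) ≠ 0 := fun h => ha (by rwa [h, norm_zero, norm_eq_zero] at hφ')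
  obtain ⟨χ, hχ⟩ := hT.exists_pontryaginDual_of_character μ φ h0
  exact ⟨χ, ⟨φ, ⟨a, h0⟩, hχ⟩, by rw [hφ', hT.character_hat μ φ h0 hχ a]⟩

/-- Where `φ(â(T)) ≠ 0`, the induced character depends continuously on `φ`: joint continuity in `(φ,
s)` gives continuity into the compact-open topology. -/
theorem isOpen_setOf_character (hT : T.IsUnitary) {V : Set (PontryaginDual G)} (hV : IsOpen V) :
    IsOpen {φ : characterSpace ℂ hT.Alg | (∃ a, φ (hT.hat μ a) ≠ 0) ∧
      ∃ χ ∈ V, ∀ s, (χ s : ℂ) = φ (hT.op s)} := by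
  rw [isOpen_iff_mem_nhds]
  rintro φ₀ ⟨⟨a, ha⟩, χ₀, hχ₀, h₀⟩
  let Ω : Set (characterSpace ℂ hT.Alg) := {φ | φ (hT.hat μ a) ≠ 0}
  have hΩ : IsOpen Ω :=
    isOpen_ne_fun (map_continuous (gelfandTransform ℂ hT.Alg (hT.hat μ a))) continuous_const
  choose f hf using fun φ : Ω => hT.exists_pontryaginDual_of_character μ φ.1 φ.2
  have hcont : Continuous f := by
    refine ContinuousMonoidHom.continuous_of_continuous_uncurry
      (f : Ω → (G →ₜ* Circle)) ?_
    suffices h : Continuous fun p : Ω × G => ((f p.1 p.2 : Circle) : ℂ) from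
      Topology.IsInducing.subtypeVal.continuous_iff.2 h
    have h1 : Continuous fun p : Ω × G =>
        gelfandTransform ℂ hT.Alg (hT.op p.2 * hT.hat μ a) p.1.1 / p.1.1 (hT.hat μ a) := by
      refine Continuous.div ?_ ?_ fun p => p.1.2
      · exact (((gelfandTransform_isometry hT.Alg).continuous.comp
          (hT.continuous_op_mul_hat μ a)).comp continuous_snd).eval
            (continuous_subtype_val.comp continuous_fst)
      · exact (map_continuous (gelfandTransform ℂ hT.Alg (hT.hat μ a))).comp
          (continuous_subtype_val.comp continuous_fst)
    refine h1.congr fun p => ?_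
    refine Eq.trans ?_ (hf p.1 p.2).symm
    change p.1.1 (hT.op p.2 * hT.hat μ a) / _ = _
    rw [map_mul, mul_div_cancel_right₀ _ p.1.2]
  have hχ₀' : f ⟨φ₀, ha⟩ = χ₀ :=
    PontryaginDual.ext fun s => Circle.ext ((hf _ s).trans (h₀ s).symm)
  have hmem : Subtype.val '' (f ⁻¹' V) ∈ 𝓝 φ₀ :=
    (hΩ.isOpenMap_subtype_val _ (hV.preimage hcont)).mem_nhds
      ⟨⟨φ₀, ha⟩, by rwa [Set.mem_preimage, hχ₀'], rfl⟩
  refine mem_of_superset hmem ?_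
  rintro _ ⟨φ, hφ, rfl⟩
  exact ⟨⟨a, φ.2⟩, f φ, hφ, hf φ⟩

omit [μ.IsMulLeftInvariant] in
/-- A representation on a nonzero space has a nonzero operator `â(T)`. -/
theorem exists_hatOp_ne_zero [T2Space G] [Nontrivial X] (hT : T.IsUnitary) [μ.IsOpenPosMeasure] :
    ∃ a, T.hatOp μ hT.isBounded a ≠ 0 := by
  obtain ⟨x, hx⟩ := exists_ne (0 : X)
  have hx' : 0 < ‖x‖ / 2 := by positivity
  have hev : ∀ᶠ s in 𝓝 (1 : G), ‖T.toHom s x - x‖ < ‖x‖ / 2 := by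
    have h : Tendsto (fun s => ‖T.toHom s x - x‖) (𝓝 1) (𝓝 ‖T.toHom 1 x - x‖) :=
      ((T.continuous_apply x).sub continuous_const).norm.tendsto 1
    rw [map_one, one_apply_eq_self, sub_self, norm_zero] at h
    exact h.eventually_lt_const hx'
  obtain ⟨K, hK, hKsub, hKc⟩ := local_compact_nhds hev
  obtain ⟨U, hUK, hU, hU1⟩ := mem_nhds_iff.1 hK
  have hUm := hU.measurableSet
  have hUfin : μ U ≠ ⊤ := ((measure_mono hUK).trans_lt hKc.measure_lt_top).ne
  have hUpos : 0 < μ.real U := ENNReal.toReal_pos (hU.measure_pos μ ⟨1, hU1⟩).ne' hUfin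
  -- On `U` the vector `T(s)x` stays within `‖x‖/2` of `x`, so its integral over `U` cannot vanish.
  refine ⟨indicatorConstLp 1 hUm hUfin 1, fun h => ?_⟩
  have h1 : ∫ s in U, T.toHom s x ∂μ = 0 := by
    have h2 := DFunLike.congr_fun h x
    rw [hatOp_apply, zero_apply] at h2
    rw [← integral_indicator hUm, ← h2]
    refine integral_congr_ae ?_
    filter_upwards [indicatorConstLp_coeFn (p := 1) (hs := hUm) (hμs := hUfin) (c := (1 : ℂ))]
      with s hs
    by_cases hsU : s ∈ U <;> simp [hs, hsU]
  have hint : IntegrableOn (fun s => T.toHom s x) U μ :=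
    ((T.continuous_apply x).continuousOn.integrableOn_compact hKc).mono_set hUK
  have h3 : ∫ s in U, (T.toHom s x - x) ∂μ = -(μ.real U • x) := by
    rw [integral_sub hint (integrableOn_const hUfin), h1, zero_sub, setIntegral_const]
  have h4 : ‖∫ s in U, (T.toHom s x - x) ∂μ‖ ≤ ‖x‖ / 2 * μ.real U :=
    norm_setIntegral_le_of_norm_le_const hUfin.lt_top fun s hs => (hKsub (hUK hs)).le
  rw [h3, norm_neg, norm_smul, Real.norm_of_nonneg hUpos.le] at h4
  nlinarith

end Hat

end IsUnitary

end StrongRep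

/-! ### Continuity of the Fourier transform -/

section Fourier

variable {G : Type*} [CommGroup G] [TopologicalSpace G] [MeasurableSpace G] [BorelSpace G]
  (μ : Measure G)

omit [MeasurableSpace G] [BorelSpace G] in
theorem continuous_coe_pontryaginDual (χ : PontryaginDual G) :
    Continuous fun s => (χ s : ℂ) :=
  continuous_subtype_val.comp (map_continuous χ)

theorem integrable_mul_pontryaginDual {f : G → ℂ} (hf : Integrable f μ) (χ : PontryaginDual G) :
    Integrable (fun s => f s * (χ s : ℂ)) μ :=
  hf.mul_bdd (c := 1) (continuous_coe_pontryaginDual χ).aestronglyMeasurable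
    (Eventually.of_forall fun s => (Circle.norm_coe (χ s)).le)

theorem fourierL1_add (a b : Lp ℂ 1 μ) (χ : PontryaginDual G) :
    fourierL1 μ (a + b) χ = fourierL1 μ a χ + fourierL1 μ b χ := by
  rw [fourierL1, fourierL1, fourierL1,
    ← integral_add (integrable_mul_pontryaginDual μ (L1.integrable_coeFn a) χ)
      (integrable_mul_pontryaginDual μ (L1.integrable_coeFn b) χ)]
  refine integral_congr_ae ((Lp.coeFn_add a b).mono fun s hs => ?_)
  simp only [hs, Pi.add_apply, add_mul]

omit [BorelSpace G] in
theorem norm_fourierL1_le_norm (a : Lp ℂ 1 μ) (χ : PontryaginDual G) :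
    ‖fourierL1 μ a χ‖ ≤ ‖a‖ := by
  rw [L1.norm_eq_integral_norm]
  refine norm_integral_le_of_norm_le (L1.integrable_coeFn a).norm
    (Eventually.of_forall fun s => ?_)
  rw [norm_mul, Circle.norm_coe, mul_one]

/-- `L¹` convergence forces uniform convergence of Fourier transforms. -/
theorem isClosed_setOf_continuous_fourierL1 :
    IsClosed {a : Lp ℂ 1 μ | Continuous (fourierL1 μ a)} := by
  refine isClosed_of_closure_subset fun a ha => ?_
  refine continuous_of_uniform_approx_of_continuous fun u hu => ?_
  obtain ⟨ε, hε, hεu⟩ := Metric.mem_uniformity_dist.1 hu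
  obtain ⟨b, hb, hab⟩ := Metric.mem_closure_iff.1 ha ε hε
  refine ⟨_, hb, fun χ => hεu ?_⟩
  have h := fourierL1_add μ (a - b) b χ
  rw [sub_add_cancel] at h
  rw [dist_eq_norm, h, add_sub_cancel_right]
  exact (norm_fourierL1_le_norm μ _ χ).trans_lt (by rwa [← dist_eq_norm])

variable [IsTopologicalGroup G] [LocallyCompactSpace G]

theorem continuous_fourierL1_indicator_of_isCompact [IsFiniteMeasureOnCompacts μ] {K : Set G}
    (hK : IsCompact K) (hKm : MeasurableSet K) (hμK : μ K ≠ ⊤) (c : ℂ) :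
    Continuous (fourierL1 μ (indicatorConstLp 1 hKm hμK c)) := by
  -- The cutoff `η` is 1 on `K`, so it leaves the integral unchanged while giving the kernel
  -- `η(s)χ(s)` compact support in `s`.
  obtain ⟨η, hη1, -, hηc, -⟩ := exists_continuous_one_zero_of_isCompact hK isClosed_empty
    (Set.disjoint_empty K)
  have heval : Continuous fun p : PontryaginDual G × G => ((p.1 p.2 : Circle) : ℂ) :=
    continuous_subtype_val.comp
      ((ContinuousMonoidHom.instContinuousEval G Circle).continuous_eval)
  have h := continuousOn_integral_bilinear_of_locally_integrable_of_compact_support (μ := μ)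
    (ContinuousLinearMap.mul ℂ ℂ) (f := fun (χ : PontryaginDual G) s => (η s : ℂ) * (χ s : ℂ))
    (s := Set.univ) (g := K.indicator fun _ => c) hηc.isCompact
    (((Complex.continuous_ofReal.comp ((map_continuous η).comp continuous_snd)).mul
      heval).continuousOn)
    (fun χ s _ hs => by rw [image_eq_zero_of_notMem_tsupport hs]; simp)
    ((integrable_indicator_iff hKm).2 (integrableOn_const hμK)).integrableOn
  rw [continuousOn_univ] at h
  refine h.congr fun χ => integral_congr_ae ?_
  filter_upwards [indicatorConstLp_coeFn (p := 1) (hs := hKm) (hμs := hμK) (c := c)] with s hs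
  by_cases hsK : s ∈ K
  · simp [hs, hsK, hη1 hsK]
  · simp [hs, hsK]

theorem continuous_fourierL1 [μ.Regular] (a : Lp ℂ 1 μ) : Continuous (fourierL1 μ a) := by
  refine Lp.induction ENNReal.one_ne_top (motive := fun a => Continuous (fourierL1 μ a))
    (fun c s hs hμs => ?_) (fun f g hf hg _ hcf hcg => ?_)
    (isClosed_setOf_continuous_fourierL1 μ) a
  · refine (isClosed_setOf_continuous_fourierL1 μ).closure_subset
      (Metric.mem_closure_iff.2 fun ε hε => ?_)
    have hδ : 0 < ε / (‖c‖ + 1) := by positivity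
    obtain ⟨K, hKs, hK, hKcl, hμK⟩ := hs.exists_isCompact_isClosed_sdiff_lt hμs.ne
      (ENNReal.ofReal_pos.2 hδ).ne'
    have hfin : μ (s \ K) ≠ ⊤ := ((measure_mono Set.sdiff_subset).trans_lt hμs).ne
    refine ⟨indicatorConstLp 1 hKcl.measurableSet hK.measure_ne_top c,
      continuous_fourierL1_indicator_of_isCompact μ hK _ _ c, ?_⟩
    rw [Lp.simpleFunc.coe_indicatorConst, dist_eq_norm]
    have h : indicatorConstLp 1 hs hμs.ne c -
        indicatorConstLp 1 hKcl.measurableSet hK.measure_ne_top c =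
        indicatorConstLp 1 (hs.diff hKcl.measurableSet) hfin c := by
      ext1
      filter_upwards [Lp.coeFn_sub (indicatorConstLp 1 hs hμs.ne c)
        (indicatorConstLp 1 hKcl.measurableSet hK.measure_ne_top c),
        indicatorConstLp_coeFn (p := 1) (hs := hs) (hμs := hμs.ne) (c := c),
        indicatorConstLp_coeFn (p := 1) (hs := hKcl.measurableSet)
          (hμs := hK.measure_ne_top (μ := μ)) (c := c),
        indicatorConstLp_coeFn (p := 1) (hs := hs.diff hKcl.measurableSet)
          (hμs := hfin) (c := c)] with x h1 h2 h3 h4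
      rw [h1, Pi.sub_apply, h2, h3, h4, Set.indicator_sdiff hKs, Pi.sub_apply]
    rw [h, norm_indicatorConstLp one_ne_zero ENNReal.one_ne_top]
    have h5 : μ.real (s \ K) < ε / (‖c‖ + 1) := by
      rw [Measure.real, ← ENNReal.toReal_ofReal hδ.le]
      exact (ENNReal.toReal_lt_toReal hfin ENNReal.ofReal_ne_top).2 hμK
    rw [ENNReal.toReal_one, div_one, Real.rpow_one]
    rw [lt_div_iff₀ (by positivity)] at h5
    nlinarith [norm_nonneg c, measureReal_nonneg (μ := μ) (s := s \ K)]
  · refine (hcf.add hcg).congr fun χ => ?_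
    rw [Pi.add_apply, ← fourierL1_add]

end Fourier

theorem ContinuousLinearMap.mem_unitary_of_norm_map {X : Type*} [NormedAddCommGroup X]
    [InnerProductSpace ℂ X] [CompleteSpace X] {u v : X →L[ℂ] X} (hu : ∀ x, ‖u x‖ = ‖x‖)
    (huv : u * v = 1) : u ∈ unitary (X →L[ℂ] X) := by
  have h : star u * u = 1 := (ContinuousLinearMap.norm_map_iff_adjoint_comp_self u).1 hu
  refine Unitary.mem_iff.2 ⟨h, ?_⟩
  rw [left_inv_eq_right_inv h huv, huv]

/-! ### Unitaries that shift the spectrum -/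

namespace StrongRep.IsUnitary

open WeakDual

section Conj

variable {G X : Type*} [CommGroup G] [TopologicalSpace G]
  [NormedAddCommGroup X] [InnerProductSpace ℂ X] [CompleteSpace X]
  {T : StrongRep G X}

/-- If `y` commutes with `T(G)`, so does `U y U*`: moving `T(s)` past `U` and `T(s)` past `U*`
produce the same scalar. -/
theorem star_mul_mul_mem_bicommutant (hT : T.IsUnitary) {U : X →L[ℂ] X}
    (hU : U ∈ unitary (X →L[ℂ] X)) {c : G → ℂ}
    (hc : ∀ s, star U * T.toHom s * U = c s • T.toHom s) {z : X →L[ℂ] X}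
    (hz : z ∈ T.bicommutant) : star U * z * U ∈ T.bicommutant := by
  obtain ⟨h1, h2⟩ := Unitary.mem_iff.1 hU
  have hTU : ∀ s, T.toHom s * U = c s • (U * T.toHom s) := fun s => by
    rw [← mul_smul_comm, ← hc, ← mul_assoc, ← mul_assoc, h2, one_mul]
  have hUT : ∀ s, star U * T.toHom s = c s • (T.toHom s * star U) := fun s => by
    rw [← smul_mul_assoc, ← hc, mul_assoc _ U, h2, mul_one]
  refine hT.mem_bicommutant_iff.2 fun y hy => ?_
  have h : (U * y * star U) * z = z * (U * y * star U) := by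
    refine hT.mem_bicommutant_iff.1 hz _ fun s => ?_
    calc T.toHom s * (U * y * star U) = (T.toHom s * U) * (y * star U) := by
          simp only [mul_assoc]
      _ = c s • (U * (T.toHom s * y) * star U) := by
          rw [hTU, smul_mul_assoc]; simp only [mul_assoc]
      _ = U * y * (star U * T.toHom s) := by
          rw [hy, hUT, mul_smul_comm]; simp only [mul_assoc]
      _ = U * y * star U * T.toHom s := by simp only [mul_assoc]
  calc y * (star U * z * U) = (star U * U) * y * (star U * z * U) := by rw [h1, one_mul]
    _ = star U * (U * y * star U * z) * U := by simp only [mul_assoc]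
    _ = star U * z * U * y * (star U * U) := by rw [h]; simp only [mul_assoc]
    _ = star U * z * U * y := by rw [h1, mul_one]

/-- Conjugation of the bicommutant by a unitary operator which multiplies each `T(s)` by a
scalar. -/
def conj (hT : T.IsUnitary) {U : X →L[ℂ] X} (hU : U ∈ unitary (X →L[ℂ] X)) {c : G → ℂ}
    (hc : ∀ s, star U * T.toHom s * U = c s • T.toHom s) : hT.Alg →⋆ₐ[ℂ] hT.Alg where
  toFun z := ⟨star U * hT.val z * U, hT.star_mul_mul_mem_bicommutant hU hc z.2⟩
  map_one' := hT.val_injective (by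
    change star U * hT.val 1 * U = hT.val 1
    rw [map_one, mul_one, (Unitary.mem_iff.1 hU).1])
  map_mul' y z := hT.val_injective (by
    change star U * hT.val (y * z) * U = (star U * hT.val y * U) * (star U * hT.val z * U)
    calc star U * hT.val (y * z) * U = star U * hT.val y * 1 * hT.val z * U := by
          rw [map_mul, mul_one]; simp only [mul_assoc]
      _ = _ := by rw [← (Unitary.mem_iff.1 hU).2]; simp only [mul_assoc])
  map_zero' := hT.val_injective (by
    change star U * hT.val 0 * U = hT.val 0
    rw [map_zero, mul_zero, zero_mul])
  map_add' y z := hT.val_injective (by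
    change star U * hT.val (y + z) * U = star U * hT.val y * U + star U * hT.val z * U
    rw [map_add, mul_add, add_mul])
  commutes' r := hT.val_injective (by
    change star U * hT.val (algebraMap ℂ hT.Alg r) * U = hT.val (algebraMap ℂ hT.Alg r)
    rw [AlgHomClass.commutes, Algebra.algebraMap_eq_smul_one, mul_smul_comm, mul_one,
      smul_mul_assoc, (Unitary.mem_iff.1 hU).1])
  map_star' z := hT.val_injective (by
    change star U * hT.val (star z) * U = star (star U * hT.val z * U)
    rw [map_star, star_mul, star_mul, star_star, mul_assoc])

variable (hT : T.IsUnitary) {U : X →L[ℂ] X} (hU : U ∈ unitary (X →L[ℂ] X)) {c : G → ℂ}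
    (hc : ∀ s, star U * T.toHom s * U = c s • T.toHom s)

theorem val_conj (z : hT.Alg) : hT.val (hT.conj hU hc z) = star U * hT.val z * U := rfl

theorem conj_op (s : G) : hT.conj hU hc (hT.op s) = c s • hT.op s :=
  hT.val_injective (by rw [val_conj, map_smul, val_op, hc])

end Conj

section Spectral

variable {G : Type*} [CommGroup G] [TopologicalSpace G] [IsTopologicalGroup G]
  [LocallyCompactSpace G] [MeasurableSpace G] [BorelSpace G]
  {X : Type*} [NormedAddCommGroup X] [InnerProductSpace ℂ X] [CompleteSpace X]
  (μ : Measure G) [μ.Regular] [μ.IsMulLeftInvariant] {T : StrongRep G X}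

/-- There is a nonzero vector with spectrum in any given open set meeting the spectrum of `T`;
it is orthogonal to its modulations which move that set off itself. -/
theorem exists_ne_zero_inner_eq_zero (hT : T.IsUnitary) {V : Set (PontryaginDual G)}
    (hV : IsOpen V) {χ₁ : PontryaginDual G} (hχ₁ : χ₁ ∈ hT.gelfandSpectrum μ) (hχ₁V : χ₁ ∈ V) :
    ∃ u : X, u ≠ 0 ∧ ∀ (χ : PontryaginDual G) (U : X →L[ℂ] X), U ∈ unitary (X →L[ℂ] X) →
      (∀ s, star U * T.toHom s * U = (χ s : ℂ) • T.toHom s) → (∀ ψ ∈ V, χ * ψ ∉ V) →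
      inner ℂ u (U u) = 0 := by
  obtain ⟨φ₁, hφ₁, hφ₁χ⟩ := hχ₁
  have hO := hT.isOpen_setOf_character μ hV
  set O := {φ : characterSpace ℂ hT.Alg | (∃ a, φ (hT.hat μ a) ≠ 0) ∧
      ∃ χ ∈ V, ∀ s, (χ s : ℂ) = φ (hT.op s)} with hOdef
  -- By Urysohn and Gelfand, `m` is an element whose transform is 1 at `φ₁` and vanishes off `O`;
  -- any nonzero `mξ` is the required vector.
  obtain ⟨f, hf0, hf1, -⟩ := exists_continuous_zero_one_of_isClosed hO.isClosed_compl
    (isClosed_singleton (x := φ₁)) (Set.disjoint_singleton_right.2 fun h =>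
      h ⟨hφ₁, χ₁, hχ₁V, hφ₁χ⟩)
  let g : C(characterSpace ℂ hT.Alg, ℂ) := ⟨fun φ => f φ, by fun_prop⟩
  obtain ⟨m, hm⟩ := (gelfandTransform_bijective hT.Alg).2 g
  have hmφ : ∀ φ : characterSpace ℂ hT.Alg, φ m = f φ := fun φ => DFunLike.congr_fun hm φ
  have hmO : ∀ φ : characterSpace ℂ hT.Alg, φ m ≠ 0 → φ ∈ O := fun φ h => by
    by_contra hφ
    exact h (by rw [hmφ, hf0 hφ]; simp)
  have hm0 : hT.val m ≠ 0 := fun h => by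
    have h0 : m = 0 := hT.val_injective (by rw [h, map_zero])
    have h1 := hmφ φ₁
    rw [h0, map_zero, hf1 (Set.mem_singleton _)] at h1
    simp at h1
  obtain ⟨ξ, hξ⟩ : ∃ ξ, hT.val m ξ ≠ 0 := by
    by_contra! h
    exact hm0 (ContinuousLinearMap.ext h)
  refine ⟨hT.val m ξ, hξ, fun χ U hU hc hχ => ?_⟩
  -- Composing `φ` with conjugation by `U` multiplies its induced character by `χ`, so both factors
  -- can be nonzero at `φ` only if `χV` meets `V`.
  have hzero : star (hT.conj hU hc m) * m = 0 := by
    refine (gelfandTransform_bijective hT.Alg).1 (ContinuousMap.ext fun φ => ?_)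
    rw [map_zero]
    change φ (star (hT.conj hU hc m) * m) = 0
    rw [map_mul, map_star]
    by_contra h
    obtain ⟨h1, h2⟩ := mul_ne_zero_iff.1 h
    obtain ⟨-, ψ, hψ, hψφ⟩ := hmO φ h2
    obtain ⟨-, ψ', hψ', hψφ'⟩ :=
      hmO (CharacterSpace.compContinuousMap (hT.conj hU hc) φ) (star_ne_zero.1 h1)
    refine hχ ψ hψ ?_
    convert hψ'
    refine PontryaginDual.ext fun s => Circle.ext ?_
    refine Eq.trans ?_ (hψφ' s).symm
    change ((χ s * ψ s : Circle) : ℂ) = φ (hT.conj hU hc (hT.op s))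
    rw [conj_op, map_smul, Circle.coe_mul, hψφ, smul_eq_mul]
  have hop : star (hT.val m) * U * hT.val m = 0 := by
    calc star (hT.val m) * U * hT.val m
        = (U * star U) * star (hT.val m) * U * hT.val m := by
          rw [(Unitary.mem_iff.1 hU).2, one_mul]
      _ = U * hT.val (star (hT.conj hU hc m) * m) := by
          rw [map_mul, map_star, val_conj, star_mul, star_mul, star_star]; simp only [mul_assoc]
      _ = 0 := by rw [hzero, map_zero, mul_zero]
  rw [← ContinuousLinearMap.adjoint_inner_right]
  have := DFunLike.congr_fun hop ξ
  rw [mul_apply_eq_comp, mul_apply_eq_comp, zero_apply, ContinuousLinearMap.star_eq_adjoint] at this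
  rw [this, inner_zero_right]

end Spectral

end StrongRep.IsUnitary

theorem exists_isOpen_forall_mul_inv_mul_mem {Γ : Type*} [Group Γ] [TopologicalSpace Γ]
    [IsTopologicalGroup Γ] {x : Γ} {t : Set Γ} (ht : t ∈ 𝓝 x) (y : Γ) :
    ∃ V : Set Γ, IsOpen V ∧ y ∈ V ∧ ∀ η ∈ V, ∀ ζ ∈ V, ζ * η⁻¹ * x ∈ t := by
  have hcont : Continuous fun p : Γ × Γ => p.2 * p.1⁻¹ * x := by fun_prop
  have hpre : (fun p : Γ × Γ => p.2 * p.1⁻¹ * x) ⁻¹' t ∈ 𝓝 (y, y) :=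
    hcont.continuousAt.preimage_mem_nhds (by simpa using ht)
  obtain ⟨V₁, V₂, hV₁, hy₁, hV₂, hy₂, hV⟩ := mem_nhds_prod_iff'.1 hpre
  exact ⟨V₁ ∩ V₂, hV₁.inter hV₂, ⟨hy₁, hy₂⟩, fun η hη ζ hζ =>
    hV (Set.mk_mem_prod hη.1 hζ.2)⟩

/-! ### Modulations on `L²(G)` -/

section Modulation

variable {G : Type*} [CommGroup G] [TopologicalSpace G] [MeasurableSpace G] [BorelSpace G]
  (μ : Measure G)

theorem memLp_mul_pontryaginDual (χ : PontryaginDual G) (f : Lp ℂ 2 μ) :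
    MemLp (fun s => (χ s : ℂ) * f s) 2 μ :=
  (Lp.memLp f).of_le ((continuous_coe_pontryaginDual χ).aestronglyMeasurable.mul
    (Lp.aestronglyMeasurable f)) (Eventually.of_forall fun s => by
      rw [norm_mul, Circle.norm_coe, one_mul])

/-- Multiplication by a character on `L²(G)`. -/
def modulation (χ : PontryaginDual G) : Lp ℂ 2 μ →L[ℂ] Lp ℂ 2 μ :=
  LinearMap.mkContinuous
    { toFun := fun f => (memLp_mul_pontryaginDual μ χ f).toLp
      map_add' := fun f g => by
        rw [← MemLp.toLp_add, MemLp.toLp_eq_toLp_iff]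
        filter_upwards [Lp.coeFn_add f g] with s hs
        simp only [hs, Pi.add_apply, mul_add]
      map_smul' := fun c f => by
        rw [RingHom.id_apply, ← MemLp.toLp_const_smul, MemLp.toLp_eq_toLp_iff]
        filter_upwards [Lp.coeFn_smul c f] with s hs
        simp only [hs, Pi.smul_apply, smul_eq_mul]
        ring } 1 fun f => by
    rw [one_mul]
    refine Lp.norm_le_norm_of_ae_le ?_
    filter_upwards [(memLp_mul_pontryaginDual μ χ f).coeFn_toLp] with s hs
    simp only [LinearMap.coe_mk, AddHom.coe_mk, hs, norm_mul, Circle.norm_coe, one_mul, le_refl]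

theorem coeFn_modulation (χ : PontryaginDual G) (f : Lp ℂ 2 μ) :
    modulation μ χ f =ᵐ[μ] fun s => (χ s : ℂ) * f s :=
  (memLp_mul_pontryaginDual μ χ f).coeFn_toLp

theorem modulation_mul_inv (χ : PontryaginDual G) :
    modulation μ χ * modulation μ χ⁻¹ = 1 := by
  ext1 f
  rw [mul_apply_eq_comp, one_apply_eq_self]
  ext1
  filter_upwards [coeFn_modulation μ χ (modulation μ χ⁻¹ f), coeFn_modulation μ χ⁻¹ f]
    with s h1 h2
  have h3 : (χ s : ℂ) * ((χ⁻¹ : PontryaginDual G) s : ℂ) = 1 := by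
    rw [← Circle.coe_mul]
    change ((χ s * (χ s)⁻¹ : Circle) : ℂ) = 1
    rw [mul_inv_cancel, Circle.coe_one]
  rw [h1, h2, ← mul_assoc, h3, one_mul]

theorem norm_modulation_apply (χ : PontryaginDual G) (f : Lp ℂ 2 μ) :
    ‖modulation μ χ f‖ = ‖f‖ := by
  refine le_antisymm (Lp.norm_le_norm_of_ae_le ?_) (Lp.norm_le_norm_of_ae_le ?_) <;>
  filter_upwards [coeFn_modulation μ χ f] with s hs <;>
  rw [hs, norm_mul, Circle.norm_coe, one_mul]

theorem modulation_mem_unitary (χ : PontryaginDual G) :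
    modulation μ χ ∈ unitary (Lp ℂ 2 μ →L[ℂ] Lp ℂ 2 μ) :=
  ContinuousLinearMap.mem_unitary_of_norm_map (norm_modulation_apply μ χ)
    (modulation_mul_inv μ χ)

variable {μ} in
/-- The function `s ↦ conj (u s) * χ s * u s` as an element of `L¹(G)`. -/
def normSqModulated (u : Lp ℂ 2 μ) (χ : PontryaginDual G) : Lp ℂ 1 μ :=
  (L2.integrable_inner (𝕜 := ℂ) u (modulation μ χ u)).toL1

/-- Orthogonality of `u` to its modulations thereby becomes vanishing of a Fourier transform. -/
theorem fourierL1_normSqModulated (u : Lp ℂ 2 μ) (χ ψ : PontryaginDual G) :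
    fourierL1 μ (normSqModulated u χ) ψ = inner ℂ u (modulation μ (ψ * χ) u) := by
  rw [fourierL1, L2.inner_def]
  refine integral_congr_ae ?_
  filter_upwards [(L2.integrable_inner (𝕜 := ℂ) u (modulation μ χ u)).coeFn_toL1,
    coeFn_modulation μ χ u, coeFn_modulation μ (ψ * χ) u] with s h1 h2 h3
  rw [normSqModulated, h1, h2, h3]
  change _ = inner ℂ (u s) (((ψ s * χ s : Circle) : ℂ) * u s)
  simp only [Circle.coe_mul, RCLike.inner_apply]
  ring

end Modulation

/-! ### The regular representation and regularity of `L¹(G)` -/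

section Regular

variable {G : Type*} [CommGroup G] [TopologicalSpace G] [IsTopologicalGroup G]
  [LocallyCompactSpace G] [MeasurableSpace G] [BorelSpace G]
  (μ : Measure G) [μ.Regular] [μ.IsMulLeftInvariant]

/-- The regular representation of `G` on `L²(G)`. -/
def regularRep : StrongRep G (Lp ℂ 2 μ) where
  toHom :=
    { toFun := fun s => (Lp.compMeasurePreservingₗᵢ ℂ (s • ·)
        (measurePreserving_smul s μ)).toContinuousLinearMap
      map_one' := by
        ext1 f
        exact one_smul Gᵈᵐᵃ f
      map_mul' := fun s t => by
        ext1 f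
        -- `DomMulAct` reverses products; commutativity of `G` undoes this.
        rw [mul_comm s t]
        exact mul_smul (DomMulAct.mk s) (DomMulAct.mk t) f }
  continuous_apply := fun f => by
    have : Fact ((2 : ENNReal) ≠ ⊤) := ⟨ENNReal.ofNat_ne_top⟩
    have h : Continuous fun s : G => DomMulAct.mk s • f :=
      (DomMulAct.continuous_mk (M := G)).smul continuous_const
    exact h

theorem regularRep_apply (s : G) (f : Lp ℂ 2 μ) :
    (regularRep μ).toHom s f = DomMulAct.mk s • f := rfl

theorem isUnitary_regularRep : (regularRep μ).IsUnitary := fun s =>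
  ContinuousLinearMap.mem_unitary_of_norm_map (v := (regularRep μ).toHom s⁻¹)
    (fun f => DomMulAct.norm_smul_Lp (DomMulAct.mk s) f)
    (by rw [← map_mul, mul_inv_cancel, map_one])

theorem regularRep_mul_modulation (s : G) (χ : PontryaginDual G) :
    (regularRep μ).toHom s * modulation μ χ =
      (χ s : ℂ) • (modulation μ χ * (regularRep μ).toHom s) := by
  ext1 f
  rw [smul_apply, mul_apply_eq_comp, mul_apply_eq_comp, regularRep_apply, regularRep_apply]
  ext1
  have hmp : MeasurePreserving (s • · : G → G) μ μ := measurePreserving_smul s μ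
  filter_upwards [DomMulAct.smul_Lp_ae_eq (DomMulAct.mk s) (modulation μ χ f),
    hmp.quasiMeasurePreserving.ae (coeFn_modulation μ χ f),
    Lp.coeFn_smul (χ s : ℂ) (modulation μ χ (DomMulAct.mk s • f)),
    coeFn_modulation μ χ (DomMulAct.mk s • f),
    DomMulAct.smul_Lp_ae_eq (DomMulAct.mk s) f] with t h1 h2 h3 h4 h5
  rw [h1, h3, Pi.smul_apply, h4, h5, Equiv.symm_apply_apply, h2, smul_eq_mul, smul_eq_mul,
    map_mul, Circle.coe_mul, mul_assoc]

theorem star_modulation_mul_regularRep_mul (s : G) (χ : PontryaginDual G) :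
    star (modulation μ χ) * (regularRep μ).toHom s * modulation μ χ =
      (χ s : ℂ) • (regularRep μ).toHom s := by
  rw [mul_assoc, regularRep_mul_modulation, mul_smul_comm, ← mul_assoc,
    (Unitary.mem_iff.1 (modulation_mem_unitary μ χ)).1, one_mul]

omit [IsTopologicalGroup G] [μ.IsMulLeftInvariant] in
theorem nontrivial_L2 [μ.IsOpenPosMeasure] : Nontrivial (Lp ℂ 2 μ) := by
  obtain ⟨U, hU1, hU, hμU⟩ := μ.exists_isOpen_measure_lt_top (1 : G)
  refine ⟨indicatorConstLp 2 hU.measurableSet hμU.ne 1, 0, fun h => ?_⟩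
  have h1 := congrArg norm h
  rw [norm_indicatorConstLp two_ne_zero ENNReal.ofNat_ne_top, norm_zero, norm_one, one_mul] at h1
  have h2 : 0 < μ.real U := ENNReal.toReal_pos (hU.measure_pos μ ⟨1, hU1⟩).ne' hμU.ne
  exact (Real.rpow_pos_of_pos h2 _).ne' h1

/-- The algebra `L¹(G)` is regular. -/
theorem exists_mem_idealJ_fourierL1_ne_zero [T2Space G] [μ.IsOpenPosMeasure]
    {Λ : Set (PontryaginDual G)} (hΛ : IsClosed Λ) {χ₀ : PontryaginDual G} (hχ₀ : χ₀ ∉ Λ) :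
    ∃ b ∈ idealJ μ Λ, fourierL1 μ b χ₀ ≠ 0 := by
  have := nontrivial_L2 μ
  have hR := isUnitary_regularRep μ
  obtain ⟨a, ha⟩ := hR.exists_hatOp_ne_zero μ
  obtain ⟨χ₁, hχ₁, -⟩ := hR.exists_norm_fourierL1_eq μ ha
  obtain ⟨t, ht, htc, htΛ⟩ := exists_mem_nhds_isClosed_subset (hΛ.isOpen_compl.mem_nhds hχ₀)
  obtain ⟨V, hV, hχ₁V, hVt⟩ := exists_isOpen_forall_mul_inv_mul_mem ht χ₁
  obtain ⟨u, hu, horth⟩ := hR.exists_ne_zero_inner_eq_zero μ hV hχ₁ hχ₁V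
  -- The twist by `χ₀⁻¹` moves the peak `⟨u, u⟩` to `χ₀`. If `ψχ₀⁻¹η = ζ` with `η, ζ ∈ V`, then `ψ =
  -- ζη⁻¹χ₀ ∈ t`, so the transform vanishes off `t`.
  refine ⟨normSqModulated u χ₀⁻¹, fun χ hχ => ?_, ?_⟩
  · filter_upwards [htc.isOpen_compl.mem_nhds fun h => htΛ h hχ] with ψ hψ
    rw [fourierL1_normSqModulated]
    refine horth _ _ (modulation_mem_unitary μ _)
      (fun s => star_modulation_mul_regularRep_mul μ s _) fun η hη hη' => hψ ?_
    have h := hVt _ hη _ hη'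
    rwa [mul_inv_cancel_right, inv_mul_cancel_right] at h
  · rw [fourierL1_normSqModulated, mul_inv_cancel]
    have h1 : modulation μ 1 u = u := by
      ext1
      filter_upwards [coeFn_modulation μ 1 u] with s hs
      rw [hs, PontryaginDual.one_apply, Circle.coe_one, one_mul]
    rw [h1]
    exact inner_self_ne_zero.2 hu

end Regular

/-! ### Comparison of the Arveson and Gelfand spectra -/

namespace StrongRep.IsUnitary

variable {G : Type*} [CommGroup G] [TopologicalSpace G] [IsTopologicalGroup G]
  [LocallyCompactSpace G] [MeasurableSpace G] [BorelSpace G]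
  {X : Type*} [NormedAddCommGroup X] [InnerProductSpace ℂ X] [CompleteSpace X]
  (μ : Measure G) [μ.Regular] [μ.IsMulLeftInvariant] {T : StrongRep G X}

omit [LocallyCompactSpace G] [μ.IsMulLeftInvariant] in
theorem spectralSubspace_eq_top_iff (hT : T.IsUnitary) {Λ : Set (PontryaginDual G)} :
    T.spectralSubspace μ hT.isBounded Λ = ⊤ ↔
      ∀ b ∈ idealJ μ Λ, T.hatOp μ hT.isBounded b = 0 := by
  simp only [spectralSubspace, iInf_eq_top, LinearMap.ker_eq_top]
  exact forall₂_congr fun b _ => ⟨fun h => by ext x; exact DFunLike.congr_fun h x,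
    fun h => by rw [h]; rfl⟩

theorem gelfandSpectrum_subset_arvesonSpectrum [T2Space G] [μ.IsOpenPosMeasure]
    (hT : T.IsUnitary) :
    hT.gelfandSpectrum μ ⊆ T.arvesonSpectrum μ hT.isBounded := by
  rintro χ hχ Λ ⟨hΛ, htop⟩
  by_contra h
  obtain ⟨b, hb, hbχ⟩ := exists_mem_idealJ_fourierL1_ne_zero μ hΛ h
  have := hT.norm_fourierL1_le μ b hχ
  rw [(hT.spectralSubspace_eq_top_iff μ).1 htop b hb, norm_zero] at this
  exact hbχ (norm_le_zero_iff.1 this)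

theorem arvesonSpectrum_subset_closure (hT : T.IsUnitary) :
    T.arvesonSpectrum μ hT.isBounded ⊆ closure (hT.gelfandSpectrum μ) := by
  refine Set.sInter_subset_of_mem ⟨isClosed_closure,
    (hT.spectralSubspace_eq_top_iff μ).2 fun b hb => ?_⟩
  by_contra h
  obtain ⟨χ, hχ, hχb⟩ := hT.exists_norm_fourierL1_eq μ h
  rw [(hb χ (subset_closure hχ)).self_of_nhds, norm_zero] at hχb
  exact h (norm_eq_zero.1 hχb.symm)

theorem norm_fourierL1_le_of_mem_arvesonSpectrum (hT : T.IsUnitary) (a : Lp ℂ 1 μ)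
    {χ : PontryaginDual G} (hχ : χ ∈ T.arvesonSpectrum μ hT.isBounded) :
    ‖fourierL1 μ a χ‖ ≤ ‖T.hatOp μ hT.isBounded a‖ :=
  closure_minimal (fun _ h => hT.norm_fourierL1_le μ a h)
    (isClosed_le (continuous_fourierL1 μ a).norm continuous_const)
    (hT.arvesonSpectrum_subset_closure μ hχ)

end StrongRep.IsUnitary

end

theorem mainTheorem3 {G : Type*} [CommGroup G] [TopologicalSpace G] [IsTopologicalGroup G]
    [LocallyCompactSpace G] [T2Space G] [MeasurableSpace G] [BorelSpace G]
    (μ : Measure G) [μ.IsHaarMeasure] [μ.Regular]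
    {X : Type*} [NormedAddCommGroup X] [InnerProductSpace ℂ X] [CompleteSpace X]
    (T : StrongRep G X) (hT : T.IsUnitary) (a : Lp ℂ 1 μ) :
    (BddAbove ((fun χ => ‖fourierL1 μ a χ‖) '' T.arvesonSpectrum μ hT.isBounded) ∧
      ‖T.hatOp μ hT.isBounded a‖ =
        sSup ((fun χ => ‖fourierL1 μ a χ‖) '' T.arvesonSpectrum μ hT.isBounded)) ∧
    (T.hatOp μ hT.isBounded a = 0 ↔
      a ∈ idealK μ (T.arvesonSpectrum μ hT.isBounded)) := by
  have hle : ∀ χ ∈ T.arvesonSpectrum μ hT.isBounded,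
      ‖fourierL1 μ a χ‖ ≤ ‖T.hatOp μ hT.isBounded a‖ :=
    fun χ hχ => hT.norm_fourierL1_le_of_mem_arvesonSpectrum μ a hχ
  have hex : T.hatOp μ hT.isBounded a ≠ 0 → ∃ χ ∈ T.arvesonSpectrum μ hT.isBounded,
      ‖fourierL1 μ a χ‖ = ‖T.hatOp μ hT.isBounded a‖ := fun h =>
    let ⟨χ, hχ, hχa⟩ := hT.exists_norm_fourierL1_eq μ h
    ⟨χ, hT.gelfandSpectrum_subset_arvesonSpectrum μ hχ, hχa⟩
  have hbdd : BddAbove ((fun χ => ‖fourierL1 μ a χ‖) '' T.arvesonSpectrum μ hT.isBounded) :=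
    ⟨_, Set.forall_mem_image.2 hle⟩
  refine ⟨⟨hbdd, le_antisymm ?_ (Real.sSup_le (Set.forall_mem_image.2 hle) (norm_nonneg _))⟩,
    fun h χ hχ => ?_, fun h => ?_⟩
  -- When `â(T) = 0` the spectrum may be empty; `Real.sSup_nonneg` also covers `sSup ∅ = 0`.
  · by_cases h : T.hatOp μ hT.isBounded a = 0
    · rw [h, norm_zero]
      exact Real.sSup_nonneg (Set.forall_mem_image.2 fun χ _ => norm_nonneg _)
    · obtain ⟨χ, hχ, hχa⟩ := hex h
      exact hχa ▸ le_csSup hbdd (Set.mem_image_of_mem _ hχ)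
  · have := hle χ hχ
    rwa [h, norm_zero, norm_le_zero_iff] at this
  · by_contra h0
    obtain ⟨χ, hχ, hχa⟩ := hex h0
    rw [h χ hχ, norm_zero] at hχa
    exact h0 (norm_eq_zero.1 hχa.symm)
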